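/- Let $T$ be an alphabet. An indexed grammar over $T$ consists of a set $\mathcal N$ of nonterminals and a set $\mathcal I$ of flags, where $\mathcal N$, $T$ and $\mathcal I$ are mutually disjoint, a start symbol $\mathbf S\in\mathcal N$, and a finite set $\mathcal P$ of productions, each of one of the forms \[ \text{(a) } A\to B^f,\qquad \text{(b) } A^f\to v,\qquad \text{(c) } A\to u, \] where $A,B\in\mathcal N$, $f\in\mathcal I$ and $u,v\in(\mathcal N\cup T)^*$. Derivations act on finite words whose letters are terminals or flagged nonterminals $A^\gamma$ with $A\in\mathcal N$, $\gamma\in\mathcal I^*$. For a word $u\in(\mathcal N\cup T)^*$ and $\gamma\in\mathcal I^*$, let $u^{\gamma}$ be $u$ with each nonterminal $B$ replaced by $B^{\gamma}$ (terminals are unchanged). A derivation step replaces one occurrence of a flagged nonterminal as follows: a production (a) replaces $A^\gamma$ by $B^{f\gamma}$; a production (b) replaces $A^{f\delta}$ by $v^{\delta}$; a production (c) replaces $A^\gamma$ by $u^{\gamma}$. The language of the grammar is the set of all words in $T^*$ that can be obtained from $\mathbf S$ (with empty flag string) by finitely many derivation steps. A language $L\subseteq T^*$ is called indexed if it is the language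 of some indexed grammar over $T$. Theorem. If $L\subseteq T^*$ is an indexed language, then its cyclic closure \[ \operatorname{cyc}(L)=\{\,w_2w_1 \mid w_1,w_2\in T^*,\ w_1w_2\in L\,\} \] is an indexed language. -/

import Mathlib

/-- A production of an indexed grammar with terminals `T`, nonterminals `N` and flags `F`. -/
inductive IndexedRule (T : Type*) (N F : Type) where
  /-- `A → B^f` -/
  | push (A B : N) (f : F)
  /-- `A^f → v` with `v` a word in nonterminals and terminals -/
  | pop (A : N) (f : F) (v : List (Symbol T N))
  /-- `A → u` with `u` a word in nonterminals and terminals -/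
  | copy (A : N) (u : List (Symbol T N))

/-- An indexed grammar over the terminals `T`. The symbol sets are not required to be finite:
only the finitely many symbols that occur in the finitely many productions (and the start
symbol) can play a role in a derivation. Disjointness of the symbol sets is automatic,
since they are separate types. -/
structure IndexedGrammar (T : Type*) where
  /-- The nonterminals. -/
  NT : Type
  /-- The indices, also called flags. -/
  Flag : Type
  /-- The start symbol. -/
  start : NT
  /-- The productions. -/
  rules : Set (IndexedRule T NT Flag)
  /-- There are finitely many productions. -/
  finite_rules : rules.Finite

/-- The word `u` with the flag string `γ` put on each of its nonterminals. The result is a word in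
terminals and flagged nonterminals `A^γ`, the latter being represented by the pairs `(A, γ)`. -/
def flagWord {T : Type*} {N F : Type} (γ : List F) (u : List (Symbol T N)) :
    List (Symbol T (N × List F)) :=
  u.map fun s => match s with
    | .terminal a => .terminal a
    | .nonterminal A => .nonterminal (A, γ)

/-- `r.Replaces A γ w`: the production `r` allows to replace an occurrence of `A^γ` by `w`. -/
inductive IndexedRule.Replaces {T : Type*} {N F : Type} :
    IndexedRule T N F → N → List F → List (Symbol T (N × List F)) → Prop
  /-- `A → B^f` replaces `A^γ` by `B^(fγ)`. -/
  | push (A B : N) (f : F) (γ : List F) :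
      Replaces (.push A B f) A γ [.nonterminal (B, f :: γ)]
  /-- `A^f → v` replaces `A^(fδ)` by `v` with `δ` on all its nonterminals. -/
  | pop (A : N) (f : F) (v : List (Symbol T N)) (δ : List F) :
      Replaces (.pop A f v) A (f :: δ) (flagWord δ v)
  /-- `A → u` replaces `A^γ` by `u` with `γ` on all its nonterminals. -/
  | copy (A : N) (u : List (Symbol T N)) (γ : List F) :
      Replaces (.copy A u) A γ (flagWord γ u)

namespace IndexedGrammar

/-- One step of a derivation: some occurrence of a flagged nonterminal `A^γ` in the word `x` is
replaced according to some production of the grammar, which gives the word `y`. -/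
def Produces {T : Type*} (G : IndexedGrammar T) (x y : List (Symbol T (G.NT × List G.Flag))) :
    Prop :=
  ∃ r ∈ G.rules, ∃ (A : G.NT) (γ : List G.Flag) (w p q : List (Symbol T (G.NT × List G.Flag))),
    r.Replaces A γ w ∧ x = p ++ [.nonterminal (A, γ)] ++ q ∧ y = p ++ w ++ q

/-- `y` is obtained from `x` by finitely many derivation steps. -/
def Derives {T : Type*} (G : IndexedGrammar T) :
    List (Symbol T (G.NT × List G.Flag)) → List (Symbol T (G.NT × List G.Flag)) → Prop :=
  Relation.ReflTransGen G.Produces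

/-- The language of the grammar: all words of terminals that can be derived from the start symbol
with the empty flag string. -/
def language {T : Type*} (G : IndexedGrammar T) : Language T :=
  {w : List T | G.Derives [.nonterminal (G.start, [])] (w.map .terminal)}

end IndexedGrammar

/-- A language is indexed if it is generated by an indexed grammar. -/
def Language.IsIndexed {T : Type*} (L : Language T) : Prop :=
  ∃ G : IndexedGrammar T, G.language = L

/-- The cyclic closure `cyc(L) = {w₂w₁ | w₁w₂ ∈ L}`. -/
def Language.cyc {T : Type*} (L : Language T) : Language T :=
  {w : List T | ∃ w₁ w₂ : List T, w₁ ++ w₂ ∈ L ∧ w = w₂ ++ w₁}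

/-!
Let `G` be an indexed grammar for `L`. A word of `cyc L` is either a word of `L`, or it is `a w₂ w₁`
where `w₁ a w₂ ∈ L`. In the second case, look at the path in a derivation tree of `w₁ a w₂` that
leads from the root to the leaf `a`, and turn it inside out. A nonterminal `A^γ` on this path splits
the yield of the rest of the tree into a part `α` on its left and a part `β` on its right, so that
`S ⇒* α A^γ β` (the relation `IndexedGrammar.Context`). The new grammar has a nonterminal `Â` such
that `Â^γ` generates exactly the words `βα`. If `A → xBy` is a production, a context `(α, β)` of
`A^γ` extends to the context `(α x^γ, y^γ β)` of `B^γ`, which gives the production `B̂ → y Â x`.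
For the other two forms of productions the flags are treated in the reverse way: `A → B^f` gives
`B̂^f → Â`, and `A^f → xBy` gives `B̂ → y Ã x` with an auxiliary nonterminal `Ã` that pushes `f` and
becomes `Â`. The path starts at the leaf `a`, where the flag string of the parent of the leaf is
guessed, and it ends at `Ŝ` with the empty flag string. As a grammar cannot test whether the flag
string is empty, each flag string carries an additional flag at its bottom, and `Ŝ` disappears
when it pops this flag.

Derivations are handled through the relation `IndexedGrammar.Yields`, which follows the derivation
tree. That the new grammar generates only words of `cyc L` is shown by giving each flagged
nonterminal the language that it should generate, and by checking that each production respects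
these languages (`IndexedGrammar.Yields.mem_wordLang`, `IndexedGrammar.cycLang_of_replaces`). The
converse is an induction along the path (`IndexedGrammar.Context.yields_hat`).
-/

/-! ### Derivation trees -/

namespace IndexedGrammar

variable {T : Type*}

/-- `G.Yields x w`: the word `x` in terminals and flagged nonterminals is the sequence of roots of a
forest of derivation trees whose leaves spell the terminal word `w`. -/
inductive Yields (G : IndexedGrammar T) :
    List (Symbol T (G.NT × List G.Flag)) → List T → Prop
  | nil : Yields G [] []
  | terminal (a : T) {x : List (Symbol T (G.NT × List G.Flag))} {w : List T} :
      Yields G x w → Yields G (.terminal a :: x) (a :: w)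
  | nonterminal {r : IndexedRule T G.NT G.Flag} {A : G.NT} {γ : List G.Flag}
      {u x : List (Symbol T (G.NT × List G.Flag))} {v w : List T} :
      r ∈ G.rules → r.Replaces A γ u → Yields G u v → Yields G x w →
      Yields G (.nonterminal (A, γ) :: x) (v ++ w)

variable {G : IndexedGrammar T}

theorem Yields.append {x y : List (Symbol T (G.NT × List G.Flag))} {v w : List T}
    (hx : G.Yields x v) (hy : G.Yields y w) : G.Yields (x ++ y) (v ++ w) := by
  induction hx with
  | nil => simpa using hy
  | terminal a _ ih => exact .terminal a ih
  | nonterminal hr hu hv _ _ ih =>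
    rw [List.append_assoc]
    exact .nonterminal hr hu hv ih

theorem Yields.exists_of_append {x y : List (Symbol T (G.NT × List G.Flag))} {w : List T}
    (h : G.Yields (x ++ y) w) : ∃ u v, G.Yields x u ∧ G.Yields y v ∧ w = u ++ v := by
  induction x generalizing w with
  | nil => exact ⟨[], w, .nil, h, rfl⟩
  | cons s x ih =>
    cases h with
    | terminal a h =>
      obtain ⟨u, v, hu, hv, rfl⟩ := ih h
      exact ⟨a :: u, v, .terminal a hu, hv, rfl⟩
    | nonterminal hr hrep h₁ h₂ =>
      obtain ⟨u, v, hu, hv, rfl⟩ := ih h₂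
      exact ⟨_ ++ u, v, .nonterminal hr hrep h₁ hu, hv, by simp⟩

theorem Yields.map_terminal (w : List T) : G.Yields (w.map .terminal) w := by
  induction w with
  | nil => exact .nil
  | cons a w ih => exact .terminal a ih

theorem Yields.single {r : IndexedRule T G.NT G.Flag} {A : G.NT} {γ : List G.Flag}
    {u : List (Symbol T (G.NT × List G.Flag))} {w : List T} (hr : r ∈ G.rules)
    (hu : r.Replaces A γ u) (hw : G.Yields u w) : G.Yields [.nonterminal (A, γ)] w := by
  simpa using Yields.nonterminal hr hu hw .nil

theorem Yields.of_produces {x y : List (Symbol T (G.NT × List G.Flag))} {w : List T}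
    (h : G.Produces x y) (hy : G.Yields y w) : G.Yields x w := by
  obtain ⟨r, hr, A, γ, u, p, q, hrep, rfl, rfl⟩ := h
  obtain ⟨_, w₃, h₁₂, h₃, rfl⟩ := hy.exists_of_append
  obtain ⟨w₁, w₂, h₁, h₂, rfl⟩ := h₁₂.exists_of_append
  exact (h₁.append (.single hr hrep h₂)).append h₃

theorem Produces.append_context {x y : List (Symbol T (G.NT × List G.Flag))} (h : G.Produces x y)
    (s t : List (Symbol T (G.NT × List G.Flag))) : G.Produces (s ++ x ++ t) (s ++ y ++ t) := by
  obtain ⟨r, hr, A, γ, u, p, q, hrep, rfl, rfl⟩ := h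
  exact ⟨r, hr, A, γ, u, s ++ p, q ++ t, hrep, by simp, by simp⟩

theorem Derives.append_context {x y : List (Symbol T (G.NT × List G.Flag))} (h : G.Derives x y)
    (s t : List (Symbol T (G.NT × List G.Flag))) : G.Derives (s ++ x ++ t) (s ++ y ++ t) :=
  Relation.ReflTransGen.lift (fun z => s ++ z ++ t)
    (fun _ _ h => Produces.append_context h s t) _ _ h

theorem derives_iff_yields {x : List (Symbol T (G.NT × List G.Flag))} {w : List T} :
    G.Derives x (w.map .terminal) ↔ G.Yields x w := by
  constructor
  · intro h
    induction h using Relation.ReflTransGen.head_induction_on with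
    | refl => exact .map_terminal w
    | head h _ ih => exact .of_produces h ih
  · intro h
    induction h with
    | nil => exact .refl
    | terminal a _ ih => simpa using ih.append_context [.terminal a] []
    | @nonterminal r A γ u x v w hr hrep _ _ ih₁ ih₂ =>
      have h₁ : G.Produces (.nonterminal (A, γ) :: x) (u ++ x) :=
        ⟨r, hr, A, γ, u, [], x, hrep, by simp, by simp⟩
      have h₂ : G.Derives (u ++ x) (v.map .terminal ++ x) := by
        simpa using ih₁.append_context [] x
      have h₃ : G.Derives (v.map .terminal ++ x) ((v ++ w).map .terminal) := by
        simpa using ih₂.append_context (v.map .terminal) []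
      exact .head h₁ (h₂.trans h₃)

theorem mem_language {w : List T} :
    w ∈ G.language ↔ G.Yields [.nonterminal (G.start, [])] w :=
  derives_iff_yields

/-! ### Interpreting nonterminals by languages -/

/-- The language of a word in terminals and nonterminals when the nonterminals are interpreted by
the languages `I`. -/
def wordLang {V : Type*} (I : V → Language T) (x : List (Symbol T V)) : Language T :=
  (x.map fun s => match s with
    | .terminal a => {[a]}
    | .nonterminal A => I A).prod

@[simp]
theorem mem_wordLang_nil {V : Type*} {I : V → Language T} {w : List T} :
    w ∈ wordLang I [] ↔ w = [] := by
  simp [wordLang, Language.mem_one]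

@[simp]
theorem mem_wordLang_terminal {V : Type*} {I : V → Language T} {a : T} {x : List (Symbol T V)}
    {w : List T} :
    w ∈ wordLang I (.terminal a :: x) ↔ ∃ v ∈ wordLang I x, w = a :: v := by
  simp only [wordLang, List.map_cons, List.prod_cons, Language.mem_mul]
  constructor
  · rintro ⟨u, hu, v, hv, rfl⟩
    obtain rfl : u = [a] := hu
    exact ⟨v, hv, rfl⟩
  · rintro ⟨v, hv, rfl⟩
    exact ⟨[a], rfl, v, hv, rfl⟩

@[simp]
theorem mem_wordLang_nonterminal {V : Type*} {I : V → Language T} {A : V}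
    {x : List (Symbol T V)} {w : List T} :
    w ∈ wordLang I (.nonterminal A :: x) ↔ ∃ u ∈ I A, ∃ v ∈ wordLang I x, w = u ++ v := by
  simp [wordLang, Language.mem_mul, eq_comm]

theorem mem_wordLang_append {V : Type*} {I : V → Language T} {x y : List (Symbol T V)}
    {w : List T} :
    w ∈ wordLang I (x ++ y) ↔ ∃ u ∈ wordLang I x, ∃ v ∈ wordLang I y, w = u ++ v := by
  simp [wordLang, Language.mem_mul, eq_comm]

/-- An interpretation that is closed under the productions contains all that is generated: the
languages generated by the flagged nonterminals are the least such interpretation. -/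
theorem Yields.mem_wordLang {I : G.NT × List G.Flag → Language T}
    (hI : ∀ r ∈ G.rules, ∀ A γ u, r.Replaces A γ u → wordLang I u ≤ I (A, γ))
    {x : List (Symbol T (G.NT × List G.Flag))} {w : List T} (h : G.Yields x w) :
    w ∈ wordLang I x := by
  induction h with
  | nil => simp
  | terminal a _ ih => exact mem_wordLang_terminal.2 ⟨_, ih, rfl⟩
  | nonterminal hr hrep _ _ ih₁ ih₂ =>
    exact mem_wordLang_nonterminal.2 ⟨_, hI _ hr _ _ _ hrep ih₁, _, ih₂, rfl⟩

/-! ### Contexts of flagged nonterminals -/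

/-- `G.Context A γ α β`: there is a derivation tree from the start symbol in which exactly one leaf
is not a terminal, namely a leaf `A^γ` with the terminal word `α` on its left and `β` on its
right. -/
inductive Context (G : IndexedGrammar T) : G.NT → List G.Flag → List T → List T → Prop
  | root : Context G G.start [] [] []
  | step {r : IndexedRule T G.NT G.Flag} {A B : G.NT} {γ δ : List G.Flag} {α β u v : List T}
      {p q : List (Symbol T (G.NT × List G.Flag))} :
      Context G A γ α β → r ∈ G.rules → r.Replaces A γ (p ++ .nonterminal (B, δ) :: q) →
      G.Yields p u → G.Yields q v → Context G B δ (α ++ u) (v ++ β)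

theorem Context.yields {A : G.NT} {γ : List G.Flag} {α β w : List T} (h : G.Context A γ α β)
    (hw : G.Yields [.nonterminal (A, γ)] w) :
    G.Yields [.nonterminal (G.start, [])] (α ++ w ++ β) := by
  induction h generalizing w with
  | root => simpa using hw
  | step _ hr hrep hu hv ih =>
    simpa using ih (.single hr hrep (hu.append (hw.append hv)))

theorem Context.exists_push_of_mem {A : G.NT} {γ : List G.Flag} {α β : List T}
    (h : G.Context A γ α β) : ∀ f ∈ γ, ∃ B C, .push B C f ∈ G.rules := by
  induction h with
  | root => simp
  | @step r A B γ δ α β u v p q _ hr hrep _ _ ih =>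
    -- the flags of a symbol on the right-hand side are flags of `A`, or the one that is pushed
    have key : ∀ {η : List G.Flag} {x : List (Symbol T G.NT)},
        p ++ .nonterminal (B, δ) :: q = flagWord η x → δ = η := by
      intro η x hx
      have hmem : Symbol.nonterminal (B, δ) ∈ flagWord η x := by simp [← hx]
      obtain ⟨s, -, hs⟩ := List.mem_map.1 hmem
      cases s with
      | terminal a => simp at hs
      | nonterminal C => simp_all
    generalize hx : p ++ Symbol.nonterminal (B, δ) :: q = x at hrep
    cases hrep with
    | push A B' f γ =>
      have hmem : Symbol.nonterminal (B, δ) ∈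
          ([.nonterminal (B', f :: γ)] : List (Symbol T (G.NT × List G.Flag))) := by simp [← hx]
      simp only [List.mem_singleton, Symbol.nonterminal.injEq, Prod.mk.injEq] at hmem
      rw [hmem.2]
      intro g hg
      rcases List.mem_cons.1 hg with rfl | hg
      · exact ⟨A, B', hr⟩
      · exact ih g hg
    | pop A f v δ' =>
      rw [key hx]
      exact fun g hg => ih g (List.mem_cons_of_mem _ hg)
    | copy A u =>
      rw [key hx]
      exact ih

/-- `G.Cut w₁ a w₂`: there is a derivation tree of `w₁ a w₂` in which the parent of the leaf `a`
between `w₁` and `w₂` is the flagged nonterminal `A^γ`, for some `A` and `γ`. -/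
def Cut (G : IndexedGrammar T) (w₁ : List T) (a : T) (w₂ : List T) : Prop :=
  ∃ r ∈ G.rules, ∃ A γ α β p q u v, G.Context A γ α β ∧ r.Replaces A γ (p ++ .terminal a :: q) ∧
    G.Yields p u ∧ G.Yields q v ∧ w₁ = α ++ u ∧ w₂ = v ++ β

/-- In a forest of derivation trees of `w₁ a w₂`, the leaf `a` is either a root itself, or it
belongs to the tree below a flagged nonterminal; in the latter case each context of this
nonterminal makes the leaf a cut. -/
theorem Yields.root_or_cut {x : List (Symbol T (G.NT × List G.Flag))} {w : List T}
    (h : G.Yields x w) : ∀ (w₁ : List T) (a : T) (w₂ : List T), w = w₁ ++ a :: w₂ →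
      (∃ p q, x = p ++ .terminal a :: q ∧ G.Yields p w₁ ∧ G.Yields q w₂) ∨
      ∃ p B δ q u v w₁' w₂', x = p ++ .nonterminal (B, δ) :: q ∧ G.Yields p u ∧ G.Yields q v ∧
        w₁ = u ++ w₁' ∧ w₂ = w₂' ++ v ∧
        ∀ α β, G.Context B δ α β → G.Cut (α ++ w₁') a (w₂' ++ β) := by
  induction h with
  | nil => simp
  | @terminal b x w hx ih =>
    intro w₁ a w₂ hw
    cases w₁ with
    | nil =>
      obtain ⟨rfl, rfl⟩ : b = a ∧ w = w₂ := by simpa using hw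
      exact .inl ⟨[], x, rfl, .nil, hx⟩
    | cons c w₁ =>
      obtain ⟨rfl, hw'⟩ : b = c ∧ w = w₁ ++ a :: w₂ := by simpa using hw
      rcases ih w₁ a w₂ hw' with ⟨p, q, rfl, hp, hq⟩ |
        ⟨p, B, δ, q, u, v, w₁', w₂', rfl, hu, hv, rfl, rfl, hcut⟩
      · exact .inl ⟨.terminal b :: p, q, rfl, .terminal b hp, hq⟩
      · exact .inr ⟨.terminal b :: p, B, δ, q, b :: u, v, w₁', w₂', rfl, .terminal b hu, hv,
          rfl, rfl, hcut⟩
  | @nonterminal r A γ u₀ x v₀ w hr hrep hu₀ hx ih₁ ih₂ =>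
    intro w₁ a w₂ hw
    rcases List.append_eq_append_iff.1 hw with ⟨c, rfl, hc⟩ | ⟨c, rfl, hc⟩
    · -- the leaf `a` belongs to the tail of the forest
      rcases ih₂ c a w₂ hc with ⟨p, q, rfl, hp, hq⟩ |
        ⟨p, B, δ, q, u, v, w₁', w₂', rfl, hu, hv, rfl, rfl, hcut⟩
      · exact .inl ⟨.nonterminal (A, γ) :: p, q, rfl, .nonterminal hr hrep hu₀ hp, hq⟩
      · exact .inr ⟨.nonterminal (A, γ) :: p, B, δ, q, v₀ ++ u, v, w₁', w₂', rfl,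
          .nonterminal hr hrep hu₀ hu, hv, by simp, rfl, hcut⟩
    · cases c with
      | nil =>
        rcases ih₂ [] a w₂ (by simpa using hc.symm) with ⟨p, q, rfl, hp, hq⟩ |
          ⟨p, B, δ, q, u, v, w₁', w₂', rfl, hu, hv, h₁, rfl, hcut⟩
        · refine .inl ⟨.nonterminal (A, γ) :: p, q, rfl, ?_, hq⟩
          simpa using Yields.nonterminal hr hrep hu₀ hp
        · obtain ⟨rfl, rfl⟩ : u = [] ∧ w₁' = [] := by simpa using h₁
          exact .inr ⟨.nonterminal (A, γ) :: p, B, δ, q, w₁ ++ [] ++ [], v, [], w₂', rfl,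
            .nonterminal hr hrep hu₀ hu, hv, by simp, rfl, hcut⟩
      | cons b c =>
        -- the leaf `a` belongs to the first tree of the forest
        obtain ⟨rfl, rfl⟩ : a = b ∧ w₂ = c ++ w := by simpa using hc
        refine .inr ⟨[], A, γ, x, [], w, w₁, c, rfl, .nil, hx, rfl, rfl, fun α β hctx => ?_⟩
        rcases ih₁ w₁ a c rfl with ⟨p, q, rfl, hp, hq⟩ |
          ⟨p, B, δ, q, u, v, w₁', w₂', rfl, hu, hv, rfl, rfl, hcut⟩
        · exact ⟨r, hr, A, γ, α, β, p, q, w₁, c, hctx, hrep, hp, hq, rfl, rfl⟩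
        · simpa using hcut _ _ (hctx.step hr hrep hu hv)

theorem Yields.cut {w₁ w₂ : List T} {a : T}
    (h : G.Yields [.nonterminal (G.start, [])] (w₁ ++ a :: w₂)) : G.Cut w₁ a w₂ := by
  rcases h.root_or_cut w₁ a w₂ rfl with ⟨p, q, hx, -, -⟩ |
    ⟨p, B, δ, q, u, v, w₁', w₂', hx, hu, hv, rfl, rfl, hcut⟩
  · have : Symbol.terminal a ∈
        ([.nonterminal (G.start, [])] : List (Symbol T (G.NT × List G.Flag))) := by simp [hx]
    simp at this
  · have hp := congrArg List.length hx
    obtain ⟨rfl, rfl⟩ : p = [] ∧ q = [] := by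
      simp only [← List.length_eq_zero_iff]
      simp at hp
      omega
    obtain ⟨rfl, rfl⟩ : G.start = B ∧ [] = δ := by simpa using hx
    cases hu
    cases hv
    simpa using hcut [] [] .root

/-! ### The grammar of the cyclic closure -/

/-- The nonterminals of the grammar of the cyclic closure, where `N` and `F` are the nonterminals
and flags of the given grammar. -/
inductive CycNT (N F : Type) : Type where
  /-- The start symbol. -/
  | start
  /-- The nonterminal that guesses the flag string at the cut. -/
  | guess
  /-- The nonterminals of the given grammar. -/
  | orig (A : N)
  /-- The nonterminal `Â`, which generates the words `βα` for all contexts `(α, β)` of `A`. -/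
  | hat (A : N)
  /-- The nonterminal `Ã`, which is to become `Â` with an additional flag `f`. -/
  | tilde (A : N) (f : F)

/-- The word `u`, read over the nonterminals of the grammar of the cyclic closure. -/
def liftWord {N : Type} (F : Type) (u : List (Symbol T N)) : List (Symbol T (CycNT N F)) :=
  u.map fun s => match s with
    | .terminal a => .terminal a
    | .nonterminal A => .nonterminal (.orig A)

/-- The production that goes up from the symbol `s` to its parent in a production with right-hand
side `x s y`, where `X` stands for the parent. The upward path starts at the terminals. -/
def turnRule {N F : Type} (X : CycNT N F) (x : List (Symbol T N)) (s : Symbol T N)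
    (y : List (Symbol T N)) : IndexedRule T (CycNT N F) (Option F) :=
  match s with
  | .terminal a => .copy .guess (.terminal a :: (liftWord F y ++ .nonterminal X :: liftWord F x))
  | .nonterminal B => .copy (.hat B) (liftWord F y ++ .nonterminal X :: liftWord F x)

/-- The productions of the grammar of the cyclic closure of the language of `G`. The flag `none` is
the mark at the bottom of the flag strings. -/
inductive CycRule (G : IndexedGrammar T) :
    IndexedRule T (CycNT G.NT G.Flag) (Option G.Flag) → Prop
  | start_orig : CycRule G (.push .start (.orig G.start) none)
  | start_guess : CycRule G (.push .start .guess none)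
  | finish : CycRule G (.pop (.hat G.start) none [])
  | push_orig {A B : G.NT} {f : G.Flag} : .push A B f ∈ G.rules →
      CycRule G (.push (.orig A) (.orig B) (some f))
  | push_guess {A B : G.NT} {f : G.Flag} : .push A B f ∈ G.rules →
      CycRule G (.push .guess .guess (some f))
  | push_hat {A B : G.NT} {f : G.Flag} : .push A B f ∈ G.rules →
      CycRule G (.pop (.hat B) (some f) [.nonterminal (.hat A)])
  | pop_orig {A : G.NT} {f : G.Flag} {v : List (Symbol T G.NT)} : .pop A f v ∈ G.rules →
      CycRule G (.pop (.orig A) (some f) (liftWord G.Flag v))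
  | pop_turn {A : G.NT} {f : G.Flag} {x y : List (Symbol T G.NT)} {s : Symbol T G.NT} :
      .pop A f (x ++ s :: y) ∈ G.rules → CycRule G (turnRule (.tilde A f) x s y)
  | pop_tilde {A : G.NT} {f : G.Flag} {v : List (Symbol T G.NT)} : .pop A f v ∈ G.rules →
      CycRule G (.push (.tilde A f) (.hat A) (some f))
  | copy_orig {A : G.NT} {u : List (Symbol T G.NT)} : .copy A u ∈ G.rules →
      CycRule G (.copy (.orig A) (liftWord G.Flag u))
  | copy_turn {A : G.NT} {x y : List (Symbol T G.NT)} {s : Symbol T G.NT} :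
      .copy A (x ++ s :: y) ∈ G.rules → CycRule G (turnRule (.hat A) x s y)

theorem finite_setOf_append_cons_eq {α : Type*} (u : List α) :
    {t : List α × α × List α | t.1 ++ t.2.1 :: t.2.2 = u}.Finite := by
  refine Set.Finite.of_injOn (f := fun t => t.1.length) (t := Set.Iic u.length) ?_ ?_
    (Set.finite_Iic _)
  · rintro ⟨x, s, y⟩ rfl
    simp
  · rintro ⟨x, s, y⟩ rfl ⟨x', s', y'⟩ h hlen
    obtain ⟨rfl, h⟩ := List.append_inj h hlen.symm
    simp_all

theorem finite_setOf_cycRule (G : IndexedGrammar T) : {r | CycRule G r}.Finite := by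
  let turns (X : CycNT G.NT G.Flag) (u : List (Symbol T G.NT)) :=
    (fun t : List (Symbol T G.NT) × Symbol T G.NT × List (Symbol T G.NT) =>
      turnRule X t.1 t.2.1 t.2.2) '' {t | t.1 ++ t.2.1 :: t.2.2 = u}
  let derived (r : IndexedRule T G.NT G.Flag) :
      Set (IndexedRule T (CycNT G.NT G.Flag) (Option G.Flag)) :=
    match r with
    | .push A B f => {.push (.orig A) (.orig B) (some f), .push .guess .guess (some f),
        .pop (.hat B) (some f) [.nonterminal (.hat A)]}
    | .pop A f v => {.pop (.orig A) (some f) (liftWord G.Flag v),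
        .push (.tilde A f) (.hat A) (some f)} ∪ turns (.tilde A f) v
    | .copy A u => {.copy (.orig A) (liftWord G.Flag u)} ∪ turns (.hat A) u
  have hturns : ∀ X u, (turns X u).Finite := fun X u => (finite_setOf_append_cons_eq u).image _
  have hderived : ∀ r, (derived r).Finite := by
    rintro (⟨A, B, f⟩ | ⟨A, f, v⟩ | ⟨A, u⟩)
    · exact Set.toFinite _
    · exact (Set.toFinite _).union (hturns _ _)
    · exact (Set.toFinite _).union (hturns _ _)
  refine (((Set.toFinite {.push .start (.orig G.start) none, .push .start .guess none,
    .pop (.hat G.start) none []}).union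
      (G.finite_rules.biUnion fun r _ => hderived r))).subset ?_
  rintro r' hr'
  cases hr' with
  | start_orig => exact .inl (by simp)
  | start_guess => exact .inl (by simp)
  | finish => exact .inl (by simp)
  | push_orig h => exact .inr (Set.mem_biUnion h (.inl rfl))
  | push_guess h => exact .inr (Set.mem_biUnion h (.inr (.inl rfl)))
  | push_hat h => exact .inr (Set.mem_biUnion h (.inr (.inr rfl)))
  | pop_orig h => exact .inr (Set.mem_biUnion h (.inl (.inl rfl)))
  | pop_turn h => exact .inr (Set.mem_biUnion h (.inr ⟨(_, _, _), rfl, rfl⟩))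
  | pop_tilde h => exact .inr (Set.mem_biUnion h (.inl (.inr rfl)))
  | copy_orig h => exact .inr (Set.mem_biUnion h (.inl rfl))
  | copy_turn h => exact .inr (Set.mem_biUnion h (.inr ⟨(_, _, _), rfl, rfl⟩))

/-- The grammar of the cyclic closure of the language of `G`. It is reducible so that its nonterminals
and flags are seen to be `CycNT G.NT G.Flag` and `Option G.Flag` by `rw` and `simp`. -/
abbrev cycGrammar (G : IndexedGrammar T) : IndexedGrammar T where
  NT := CycNT G.NT G.Flag
  Flag := Option G.Flag
  start := .start
  rules := {r | CycRule G r}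
  finite_rules := finite_setOf_cycRule G

/-- The flag string `γ` with the mark added at its bottom. -/
def markFlags {F : Type} (γ : List F) : List (Option F) :=
  γ.map some ++ [none]

@[simp]
theorem markFlags_nil {F : Type} : markFlags ([] : List F) = [none] := rfl

@[simp]
theorem markFlags_cons {F : Type} (f : F) (γ : List F) :
    markFlags (f :: γ) = some f :: markFlags γ := rfl

/-- A flag string with bottom mark that starts with the mark consists of the mark only. -/
theorem markFlags_eq_none_cons {F : Type} {γ : List F} {δ : List (Option F)}
    (h : none :: δ = markFlags γ) : γ = [] := by
  cases γ with
  | nil => rfl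
  | cons f γ => simp at h

theorem markFlags_eq_some_cons {F : Type} {f : F} {γ : List F} {δ : List (Option F)}
    (h : some f :: δ = markFlags γ) : ∃ γ', γ = f :: γ' ∧ δ = markFlags γ' := by
  cases γ with
  | nil => simp at h
  | cons g γ =>
    obtain ⟨rfl, rfl⟩ : f = g ∧ δ = markFlags γ := by simpa using h
    exact ⟨γ, rfl, rfl⟩

/-- A word in terminals and flagged nonterminals of the given grammar, read over the grammar of the
cyclic closure. -/
def embedWord {N F : Type} (x : List (Symbol T (N × List F))) :
    List (Symbol T (CycNT N F × List (Option F))) :=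
  x.map fun s => match s with
    | .terminal a => .terminal a
    | .nonterminal A => .nonterminal (.orig A.1, markFlags A.2)

@[simp]
theorem flagWord_append {N F : Type} (γ : List F) (x y : List (Symbol T N)) :
    flagWord γ (x ++ y) = flagWord γ x ++ flagWord γ y :=
  List.map_append

@[simp]
theorem flagWord_terminal_cons {N F : Type} (γ : List F) (a : T) (x : List (Symbol T N)) :
    flagWord γ (.terminal a :: x) = .terminal a :: flagWord γ x := rfl

@[simp]
theorem flagWord_nonterminal_cons {N F : Type} (γ : List F) (A : N) (x : List (Symbol T N)) :
    flagWord γ (.nonterminal A :: x) = .nonterminal (A, γ) :: flagWord γ x := rfl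

@[simp]
theorem flagWord_nil {N F : Type} (γ : List F) : flagWord γ ([] : List (Symbol T N)) = [] := rfl

theorem flagWord_liftWord {N F : Type} (γ : List F) (u : List (Symbol T N)) :
    flagWord (markFlags γ) (liftWord F u) = embedWord (flagWord γ u) := by
  simp only [flagWord, liftWord, embedWord, List.map_map]
  refine List.map_congr_left fun s _ => ?_
  cases s <;> rfl

/-! ### The new grammar generates only words of the cyclic closure -/

/-- The language that a nonterminal of the grammar of the cyclic closure generates with flag string
`γ` and the mark at the bottom. -/
def markedLang (G : IndexedGrammar T) : CycNT G.NT G.Flag → List G.Flag → Language T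
  | .start, _ => ⊤
  | .guess, _ => G.language.cyc
  | .orig A, γ => {w | G.Yields [.nonterminal (A, γ)] w}
  | .hat A, γ => {w | ∃ α β, G.Context A γ α β ∧ w = β ++ α}
  | .tilde A f, γ => {w | ∃ α β, G.Context A (f :: γ) α β ∧ w = β ++ α}

/-- The interpretation of the flagged nonterminals of the grammar of the cyclic closure. Flag
strings without a mark at the bottom matter only at the start symbol, where the flag string is
empty. A nonterminal with any other such flag string gets the language of all words, so that no
production that starts from it needs attention. -/
def cycLang (G : IndexedGrammar T) (A : CycNT G.NT G.Flag × List (Option G.Flag)) : Language T :=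
  {w | (A = (.start, []) → w ∈ G.language.cyc) ∧
    ∀ γ, A.2 = markFlags γ → w ∈ markedLang G A.1 γ}

theorem mem_markedLang_of_mem_cycLang {A : CycNT G.NT G.Flag} {γ : List G.Flag} {w : List T}
    (h : w ∈ cycLang G (A, markFlags γ)) : w ∈ markedLang G A γ :=
  h.2 γ rfl

theorem mem_cycLang {A : CycNT G.NT G.Flag} {γ' : List (Option G.Flag)} {w : List T}
    (hA : A ≠ .start) (h : ∀ γ, γ' = markFlags γ → w ∈ markedLang G A γ) :
    w ∈ cycLang G (A, γ') :=
  ⟨fun hs => absurd (congrArg Prod.fst hs) hA, h⟩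

theorem yields_of_mem_wordLang_embedWord {x : List (Symbol T (G.NT × List G.Flag))} {w : List T}
    (h : w ∈ wordLang (cycLang G) (embedWord x)) : G.Yields x w := by
  induction x generalizing w with
  | nil =>
    obtain rfl := mem_wordLang_nil.1 h
    exact .nil
  | cons s x ih =>
    cases s with
    | terminal a =>
      obtain ⟨v, hv, rfl⟩ := mem_wordLang_terminal.1 h
      exact .terminal a (ih hv)
    | nonterminal A =>
      obtain ⟨u, hu, v, hv, rfl⟩ := mem_wordLang_nonterminal.1 h
      have hu : G.Yields [.nonterminal A] u := mem_markedLang_of_mem_cycLang hu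
      exact hu.append (ih hv)

theorem exists_of_mem_wordLang_turn {X : CycNT G.NT G.Flag} {x y : List (Symbol T G.NT)}
    {γ : List G.Flag} {w : List T}
    (h : w ∈ wordLang (cycLang G) (flagWord (markFlags γ)
      (liftWord G.Flag y ++ .nonterminal X :: liftWord G.Flag x))) :
    ∃ u v t, G.Yields (flagWord γ x) u ∧ G.Yields (flagWord γ y) v ∧ t ∈ markedLang G X γ ∧
      w = v ++ t ++ u := by
  simp only [flagWord_append, flagWord_nonterminal_cons, flagWord_liftWord,
    mem_wordLang_append, mem_wordLang_nonterminal] at h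
  obtain ⟨v, hv, _, ⟨t, ht, u, hu, rfl⟩, rfl⟩ := h
  exact ⟨u, v, t, yields_of_mem_wordLang_embedWord hu, yields_of_mem_wordLang_embedWord hv,
    mem_markedLang_of_mem_cycLang ht, by simp⟩

/-- The productions that go up from a symbol to its parent `A^δ` respect the interpretation. Here
`X` stands for the parent, which passes the flag string `γ` to its children. -/
theorem cycLang_of_replaces_turnRule {r : IndexedRule T G.NT G.Flag} (hr : r ∈ G.rules)
    {X : CycNT G.NT G.Flag} {A : G.NT} {x y : List (Symbol T G.NT)} {s : Symbol T G.NT}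
    (δ : List G.Flag → List G.Flag)
    (hX : ∀ γ, markedLang G X γ = markedLang G (.hat A) (δ γ))
    (hrep : ∀ γ, r.Replaces A (δ γ) (flagWord γ (x ++ s :: y)))
    {B : CycNT G.NT G.Flag} {γ' : List (Option G.Flag)}
    {u' : List (Symbol T (CycNT G.NT G.Flag × List (Option G.Flag)))}
    (h : (turnRule X x s y).Replaces B γ' u') :
    wordLang (cycLang G) u' ≤ cycLang G (B, γ') := by
  intro w hw
  cases s with
  | terminal a =>
    cases h
    refine mem_cycLang (by simp) ?_
    rintro γ rfl
    rw [flagWord_terminal_cons] at hw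
    obtain ⟨w, hw', rfl⟩ := mem_wordLang_terminal.1 hw
    obtain ⟨u, v, t, hu, hv, ht, rfl⟩ := exists_of_mem_wordLang_turn hw'
    rw [hX] at ht
    obtain ⟨α, β, hctx, rfl⟩ := ht
    have hyield := hctx.yields (.single hr (hrep γ) (w := u ++ a :: v) (by
      rw [flagWord_append, flagWord_terminal_cons]
      exact hu.append (.terminal a hv)))
    exact ⟨α ++ u, a :: (v ++ β), mem_language.2 (by simpa using hyield), by simp⟩
  | nonterminal B =>
    cases h
    refine mem_cycLang (by simp) ?_
    rintro γ rfl
    obtain ⟨u, v, t, hu, hv, ht, rfl⟩ := exists_of_mem_wordLang_turn hw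
    rw [hX] at ht
    obtain ⟨α, β, hctx, rfl⟩ := ht
    have h := hrep γ
    rw [flagWord_append, flagWord_nonterminal_cons] at h
    exact ⟨α ++ u, v ++ β, hctx.step hr h hu hv, by simp⟩

theorem cycLang_of_replaces {r' : IndexedRule T (CycNT G.NT G.Flag) (Option G.Flag)}
    (hr' : CycRule G r') {B : CycNT G.NT G.Flag} {γ' : List (Option G.Flag)}
    {u' : List (Symbol T (CycNT G.NT G.Flag × List (Option G.Flag)))}
    (h : r'.Replaces B γ' u') : wordLang (cycLang G) u' ≤ cycLang G (B, γ') := by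
  cases hr' with
  | pop_turn hr => exact cycLang_of_replaces_turnRule hr (_ :: ·) (fun _ => rfl) (.pop _ _ _) h
  | copy_turn hr => exact cycLang_of_replaces_turnRule hr id (fun _ => rfl) (.copy _ _) h
  | start_orig =>
    cases h
    intro w hw
    refine ⟨fun hs => ?_, fun _ _ => trivial⟩
    obtain rfl : γ' = [] := congrArg Prod.snd hs
    have hw : G.Yields [.nonterminal (G.start, [])] w := yields_of_mem_wordLang_embedWord hw
    exact ⟨w, [], mem_language.2 (by simpa using hw), by simp⟩
  | start_guess =>
    cases h
    intro w hw
    refine ⟨fun hs => ?_, fun _ _ => trivial⟩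
    obtain rfl : γ' = [] := congrArg Prod.snd hs
    obtain ⟨w, hw', _, hnil, rfl⟩ := mem_wordLang_nonterminal.1 hw
    obtain rfl := mem_wordLang_nil.1 hnil
    rw [List.append_nil]
    exact mem_markedLang_of_mem_cycLang (γ := []) hw'
  | finish =>
    cases h
    intro w hw
    obtain rfl := mem_wordLang_nil.1 hw
    refine mem_cycLang (by simp) fun γ hγ => ?_
    obtain rfl := markFlags_eq_none_cons hγ
    exact ⟨[], [], .root, rfl⟩
  | push_orig hr =>
    cases h
    intro w hw
    refine mem_cycLang (by simp) ?_
    rintro γ rfl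
    exact .single hr (.push _ _ _ _) (yields_of_mem_wordLang_embedWord hw)
  | push_guess hr =>
    cases h
    intro w hw
    refine mem_cycLang (by simp) ?_
    rintro γ rfl
    obtain ⟨w, hw', _, hnil, rfl⟩ := mem_wordLang_nonterminal.1 hw
    obtain rfl := mem_wordLang_nil.1 hnil
    rw [List.append_nil]
    exact mem_markedLang_of_mem_cycLang (A := .guess) (γ := _ :: γ) hw'
  | push_hat hr =>
    cases h
    intro w hw
    refine mem_cycLang (by simp) fun γ hγ => ?_
    obtain ⟨γ, rfl, rfl⟩ := markFlags_eq_some_cons hγ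
    obtain ⟨w, hw', _, hnil, rfl⟩ := mem_wordLang_nonterminal.1 hw
    obtain rfl := mem_wordLang_nil.1 hnil
    obtain ⟨α, β, hctx, rfl⟩ := mem_markedLang_of_mem_cycLang hw'
    exact ⟨α ++ [], [] ++ β, hctx.step (p := []) (q := []) hr (.push _ _ _ _) .nil .nil, by simp⟩
  | pop_orig hr =>
    cases h
    intro w hw
    refine mem_cycLang (by simp) fun γ hγ => ?_
    obtain ⟨γ, rfl, rfl⟩ := markFlags_eq_some_cons hγ
    rw [flagWord_liftWord] at hw
    exact .single hr (.pop _ _ _ _) (yields_of_mem_wordLang_embedWord hw)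
  | @pop_tilde A f _ hr =>
    cases h
    intro w hw
    refine mem_cycLang (by simp) ?_
    rintro γ rfl
    obtain ⟨w, hw', _, hnil, rfl⟩ := mem_wordLang_nonterminal.1 hw
    obtain rfl := mem_wordLang_nil.1 hnil
    rw [List.append_nil]
    exact mem_markedLang_of_mem_cycLang (A := .hat A) (γ := f :: γ) hw'
  | copy_orig hr =>
    cases h
    intro w hw
    refine mem_cycLang (by simp) ?_
    rintro γ rfl
    rw [flagWord_liftWord] at hw
    exact .single hr (.copy _ _ _) (yields_of_mem_wordLang_embedWord hw)

theorem mem_cyc_of_mem_language_cycGrammar {w : List T} (hw : w ∈ G.cycGrammar.language) :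
    w ∈ G.language.cyc := by
  have h := (mem_language.1 hw).mem_wordLang (G := G.cycGrammar) (I := cycLang G)
    fun _ hr _ _ _ hrep => cycLang_of_replaces hr hrep
  obtain ⟨w, hw', _, hnil, rfl⟩ := mem_wordLang_nonterminal.1 h
  obtain rfl := mem_wordLang_nil.1 hnil
  rw [List.append_nil]
  exact hw'.1 rfl

/-! ### The new grammar generates all words of the cyclic closure -/

theorem Yields.embedWord {x : List (Symbol T (G.NT × List G.Flag))} {w : List T}
    (h : G.Yields x w) : G.cycGrammar.Yields (embedWord x) w := by
  induction h with
  | nil => exact .nil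
  | terminal a _ ih => exact .terminal a ih
  | nonterminal hr hrep _ _ ih₁ ih₂ =>
    cases hrep with
    | push A B f γ => exact .nonterminal (G := G.cycGrammar) (.push_orig hr) (.push _ _ _ _) ih₁ ih₂
    | pop A f v δ =>
      rw [← flagWord_liftWord] at ih₁
      exact .nonterminal (G := G.cycGrammar) (.pop_orig hr) (.pop _ _ _ _) ih₁ ih₂
    | copy A u γ =>
      rw [← flagWord_liftWord] at ih₁
      exact .nonterminal (G := G.cycGrammar) (.copy_orig hr) (.copy _ _ _) ih₁ ih₂

theorem Yields.turn {X : CycNT G.NT G.Flag} {x y : List (Symbol T G.NT)} {γ : List G.Flag}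
    {u v t : List T} (hu : G.Yields (flagWord γ x) u) (hv : G.Yields (flagWord γ y) v)
    (ht : G.cycGrammar.Yields [.nonterminal (X, markFlags γ)] t) :
    G.cycGrammar.Yields (flagWord (markFlags γ)
      (liftWord G.Flag y ++ .nonterminal X :: liftWord G.Flag x)) (v ++ (t ++ u)) := by
  rw [flagWord_append, flagWord_nonterminal_cons, flagWord_liftWord, flagWord_liftWord]
  exact hv.embedWord.append (ht.append hu.embedWord)

theorem Yields.tilde {A : G.NT} {f : G.Flag} {γ : List G.Flag} {v : List (Symbol T G.NT)}
    {w : List T} (hr : .pop A f v ∈ G.rules)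
    (h : G.cycGrammar.Yields [.nonterminal (.hat A, markFlags (f :: γ))] w) :
    G.cycGrammar.Yields [.nonterminal (.tilde A f, markFlags γ)] w :=
  .single (G := G.cycGrammar) (.pop_tilde hr) (.push _ _ _ _) h

theorem exists_of_append_cons_eq_flagWord {N F : Type} {γ : List F} {u : List (Symbol T N)}
    {p q : List (Symbol T (N × List F))} {s : Symbol T (N × List F)}
    (h : p ++ s :: q = flagWord γ u) :
    ∃ x s' y, u = x ++ s' :: y ∧ p = flagWord γ x ∧ [s] = flagWord γ [s'] ∧
      q = flagWord γ y := by
  obtain ⟨x, z, rfl, rfl, hz⟩ := List.map_eq_append_iff.1 h.symm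
  obtain ⟨s', y, rfl, rfl, rfl⟩ := List.map_eq_cons_iff.1 hz
  exact ⟨x, s', y, rfl, rfl, rfl, rfl⟩

theorem Context.yields_hat {A : G.NT} {γ : List G.Flag} {α β : List T}
    (h : G.Context A γ α β) :
    G.cycGrammar.Yields [.nonterminal (.hat A, markFlags γ)] (β ++ α) := by
  induction h with
  | root => exact .single (G := G.cycGrammar) .finish (.pop _ _ _ _) .nil
  | @step r A B γ δ α β u v p q _ hr hrep hu hv ih =>
    generalize hx : p ++ Symbol.nonterminal (B, δ) :: q = x at hrep
    cases hrep with
    | push A B' f γ =>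
      have hp := congrArg List.length hx
      obtain ⟨rfl, rfl⟩ : p = [] ∧ q = [] := by
        simp only [← List.length_eq_zero_iff]
        simp at hp
        omega
      obtain ⟨rfl, rfl⟩ : B = B' ∧ δ = f :: γ := by simpa using hx
      cases hu
      cases hv
      simp only [List.append_nil, List.nil_append]
      exact .single (G := G.cycGrammar) (.push_hat hr) (.pop _ _ _ _) ih
    | pop A f v' γ =>
      obtain ⟨x, s, y, rfl, rfl, hs, rfl⟩ := exists_of_append_cons_eq_flagWord hx
      cases s with
      | terminal a => simp at hs
      | nonterminal C =>
        obtain ⟨rfl, rfl⟩ : B = C ∧ δ = γ := by simpa using hs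
        simpa using Yields.single (G := G.cycGrammar) (.pop_turn hr) (.copy _ _ _)
          (hu.turn hv (.tilde hr ih))
    | copy A u' =>
      obtain ⟨x, s, y, rfl, rfl, hs, rfl⟩ := exists_of_append_cons_eq_flagWord hx
      cases s with
      | terminal a => simp at hs
      | nonterminal C =>
        obtain ⟨rfl, rfl⟩ : B = C ∧ δ = γ := by simpa using hs
        simpa using Yields.single (G := G.cycGrammar) (.copy_turn hr) (.copy _ _ _)
          (hu.turn hv ih)

theorem Cut.exists_yields_guess {w₁ w₂ : List T} {a : T} (h : G.Cut w₁ a w₂) :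
    ∃ γ : List G.Flag, (∀ f ∈ γ, ∃ B C, .push B C f ∈ G.rules) ∧
      G.cycGrammar.Yields [.nonterminal (.guess, markFlags γ)] (a :: w₂ ++ w₁) := by
  obtain ⟨r, hr, A, γ, α, β, p, q, u, v, hctx, hrep, hu, hv, rfl, rfl⟩ := h
  have hγ := hctx.exists_push_of_mem
  have hhat := hctx.yields_hat
  generalize hx : p ++ Symbol.terminal a :: q = x at hrep
  cases hrep with
  | push A B' f γ =>
    have hmem : Symbol.terminal a ∈
        ([.nonterminal (B', f :: γ)] : List (Symbol T (G.NT × List G.Flag))) := by simp [← hx]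
    simp at hmem
  | pop A f v' γ =>
    refine ⟨γ, fun g hg => hγ g (List.mem_cons_of_mem _ hg), ?_⟩
    obtain ⟨x, s, y, rfl, rfl, hs, rfl⟩ := exists_of_append_cons_eq_flagWord hx
    cases s with
    | nonterminal C => simp at hs
    | terminal b =>
      obtain rfl : a = b := by simpa using hs
      simpa using Yields.single (G := G.cycGrammar) (.pop_turn hr) (.copy _ _ _)
        (.terminal a (hu.turn hv (.tilde hr hhat)))
  | copy A u' =>
    refine ⟨γ, hγ, ?_⟩
    obtain ⟨x, s, y, rfl, rfl, hs, rfl⟩ := exists_of_append_cons_eq_flagWord hx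
    cases s with
    | nonterminal C => simp at hs
    | terminal b =>
      obtain rfl : a = b := by simpa using hs
      simpa using Yields.single (G := G.cycGrammar) (.copy_turn hr) (.copy _ _ _)
        (.terminal a (hu.turn hv hhat))

theorem Yields.start_of_guess {γ : List G.Flag} (hγ : ∀ f ∈ γ, ∃ B C, .push B C f ∈ G.rules)
    {w : List T} (h : G.cycGrammar.Yields [.nonterminal (.guess, markFlags γ)] w) :
    G.cycGrammar.Yields [.nonterminal (.start, [])] w := by
  induction γ with
  | nil => exact .single (G := G.cycGrammar) .start_guess (.push _ _ _ _) h
  | cons f γ ih =>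
    obtain ⟨B, C, hr⟩ := hγ f List.mem_cons_self
    exact ih (fun g hg => hγ g (List.mem_cons_of_mem _ hg))
      (.single (G := G.cycGrammar) (.push_guess hr) (.push _ _ _ _) h)

theorem mem_language_cycGrammar_of_mem_cyc {w : List T} (hw : w ∈ G.language.cyc) :
    w ∈ G.cycGrammar.language := by
  obtain ⟨w₁, w₂, h, rfl⟩ := hw
  rw [mem_language] at h ⊢
  cases w₂ with
  | nil =>
    rw [List.append_nil] at h
    exact .single (G := G.cycGrammar) .start_orig (.push _ _ _ _) h.embedWord
  | cons a w₂ =>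
    obtain ⟨γ, hγ, hguess⟩ := h.cut.exists_yields_guess
    exact .start_of_guess hγ hguess

end IndexedGrammar

theorem mainTheorem1 {T : Type*} (L : Language T) (hL : L.IsIndexed) : L.cyc.IsIndexed := by
  obtain ⟨G, rfl⟩ := hL
  exact ⟨G.cycGrammar, Set.Subset.antisymm
    (fun _ => IndexedGrammar.mem_cyc_of_mem_language_cycGrammar)
    (fun _ => IndexedGrammar.mem_language_cycGrammar_of_mem_cyc)⟩
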